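/- Let $d,N\ge 1$, let $f_1,\dots,f_N:\mathbb R^d\to\mathbb R$ be twice differentiable and $F=\frac1N\sum_{i=1}^N f_i$. Assume that $F$ is bounded below and that for every $i$ the function $f_i$, its gradient $\nabla f_i$ and its Hessian $\nabla^2 f_i$ are Lipschitz continuous with constants $L_0>0$, $L_1>0$ and $L_2\ge 0$, respectively (Euclidean norm for vectors, spectral norm for matrices). Consider the sub-sampled cubic regularization method (SCR) with parameter $M>0$ and starting point $x_0\in\mathbb R^d$: at iteration $k=0,1,2,\dots$ index sets $\xi_g(k),\xi_H(k)\subseteq\{1,\dots,N\}$ are sampled, one forms $$g_k=\frac1{|\xi_g(k)|}\sum_{i\in\xi_g(k)}\nabla f_i(x_k),\qquad H_k=\frac1{|\xi_H(k)|}\sum_{i\in\xi_H(k)}\nabla^2 f_i(x_k),$$ and one sets $x_{k+1}=x_k+s_{k+1}$, where $s_{k+1}$ is a global minimizer over $s\in\mathbb R^d$ of $g_k^\top s+\frac12 s^\top H_k s+\frac M6\|s\|^3$. The sampling is without replacement: the sizes $|\xi_g(k)|$ and $|\xi_H(k)|$ are determined by the history before iteration $k$ (which also determines $x_k$), and, conditionally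 on this history, each of $\xi_g(k)$ and $\xi_H(k)$ is uniformly distributed over all subsets of $\{1,\dots,N\}$ of its size. No assumption is made on the joint law of $\xi_g(k)$ and $\xi_H(k)$. Let $C_1,C_2\ge 0$ and $0<\zeta<1$. Then for every $k\ge 0$ the following holds. 1. (Gradient.) With probability at least $1-\zeta$, the sample size condition $$|\xi_g(k)|\ \ge\ \left(\frac1N+\frac{C_1^2\|x_{k+1}-x_k\|^4}{64L_0^2\log(2(d+1)/\zeta)}\right)^{-1}\qquad(\mathrm G)$$ implies $\|g_k-\nabla F(x_k)\|\le C_1\|s_{k+1}\|^2$; that is, the event that (G) fails or this inequality holds has probability at least $1-\zeta$. In particular, if (G) holds almost surely, then $\|g_k-\nabla F(x_k)\|\le C_1\|s_{k+1}\|^2$ with probability at least $1-\zeta$. 2. (Hessian.) With probability at least $1-\zeta$, the sample size condition $$|\xi_H(k)|\ \ge\ \left(\frac1N+\frac{C_2^2\|x_{k+1}-x_k\|^2}{64L_1^2\log(4d/\zeta)}\right)^{-1}\qquad(\mathrm H)$$ implies $\|(H_k-\nabla^2F(x_k))s_{k+1}\|\le C_2\|s_{k+1}\|^2$; that is, the event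 that (H) fails or this inequality holds has probability at least $1-\zeta$. In particular, if (H) holds almost surely, then $\|(H_k-\nabla^2F(x_k))s_{k+1}\|\le C_2\|s_{k+1}\|^2$ with probability at least $1-\zeta$. -/

import Mathlib

open MeasureTheory ProbabilityTheory
open scoped NNReal RealInnerProductSpace

namespace SubsampledCubic

noncomputable section

/-- The Hessian of `f` at `x`, the derivative of the gradient, as a linear operator on `ℝ^d`.
Its operator norm is the spectral norm of the Hessian matrix. -/
def hessian {d : ℕ} (f : EuclideanSpace ℝ (Fin d) → ℝ) (x : EuclideanSpace ℝ (Fin d)) :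
    EuclideanSpace ℝ (Fin d) →L[ℝ] EuclideanSpace ℝ (Fin d) :=
  fderiv ℝ (gradient f) x

/-- The finite-sum objective `F = (1/N) ∑ f_i`. -/
def objective {d N : ℕ} (f : Fin N → EuclideanSpace ℝ (Fin d) → ℝ)
    (x : EuclideanSpace ℝ (Fin d)) : ℝ :=
  (N : ℝ)⁻¹ * ∑ i, f i x

/-- Standing assumption on the finite-sum objective: `F` is bounded below, every `f_i` is twice
differentiable, and `f_i`, its gradient and its Hessian are Lipschitz continuous with constants
`L₀`, `L₁`, `L₂`. -/
structure IsRegularObjective {d N : ℕ} (f : Fin N → EuclideanSpace ℝ (Fin d) → ℝ)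
    (L₀ L₁ L₂ : ℝ≥0) : Prop where
  bddBelow : BddBelow (Set.range (objective f))
  differentiable : ∀ i, Differentiable ℝ (f i)
  differentiable_gradient : ∀ i, Differentiable ℝ (gradient (f i))
  lipschitz : ∀ i, LipschitzWith L₀ (f i)
  lipschitz_gradient : ∀ i, LipschitzWith L₁ (gradient (f i))
  lipschitz_hessian : ∀ i, LipschitzWith L₂ (hessian (f i))

/-- The mini-batch gradient `(1/|S|) ∑_{i ∈ S} ∇ f_i(x)`. -/
def batchGradient {d N : ℕ} (f : Fin N → EuclideanSpace ℝ (Fin d) → ℝ) (S : Finset (Fin N))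
    (x : EuclideanSpace ℝ (Fin d)) : EuclideanSpace ℝ (Fin d) :=
  (S.card : ℝ)⁻¹ • ∑ i ∈ S, gradient (f i) x

/-- The mini-batch Hessian `(1/|S|) ∑_{i ∈ S} ∇² f_i(x)`. -/
def batchHessian {d N : ℕ} (f : Fin N → EuclideanSpace ℝ (Fin d) → ℝ) (S : Finset (Fin N))
    (x : EuclideanSpace ℝ (Fin d)) :
    EuclideanSpace ℝ (Fin d) →L[ℝ] EuclideanSpace ℝ (Fin d) :=
  (S.card : ℝ)⁻¹ • ∑ i ∈ S, hessian (f i) x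

/-- The cubic model `gᵀ s + (1/2) sᵀ H s + (M/6) ‖s‖³`. -/
def cubicModel {d : ℕ} (g : EuclideanSpace ℝ (Fin d))
    (H : EuclideanSpace ℝ (Fin d) →L[ℝ] EuclideanSpace ℝ (Fin d)) (M : ℝ)
    (s : EuclideanSpace ℝ (Fin d)) : ℝ :=
  ⟪g, s⟫ + (1 / 2) * ⟪s, H s⟫ + (M / 6) * ‖s‖ ^ 3

/-- `ξ` is drawn by sampling without replacement, given the past `𝒢`: the batch size `|ξ|` is
fixed by the past, and conditionally on the past `ξ` is uniformly distributed over all subsets of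
the index set that have this cardinality. -/
structure IsSampledWithoutReplacement {Ω : Type*} {mΩ : MeasurableSpace Ω} (μ : Measure Ω)
    (𝒢 : MeasurableSpace Ω) {N : ℕ} (ξ : Ω → Finset (Fin N)) : Prop where
  measurableSet_eq : ∀ S, MeasurableSet[mΩ] {ω | ξ ω = S}
  measurable_card : Measurable[𝒢] fun ω => (ξ ω).card
  uniform : ∀ S : Finset (Fin N), μ⟦{ω | ξ ω = S} | 𝒢⟧ =ᵐ[μ]
    fun ω => if S.card = (ξ ω).card then ((N.choose (ξ ω).card : ℕ) : ℝ)⁻¹ else 0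

/-- `(x, s, ξg, ξH)` is a run of the sub-sampled cubic regularization method with sampling without
replacement, where `ℱ k` is the history available at the beginning of iteration `k`. Batch sizes
may depend on the history, and nothing is required about the joint law of the two index sets
of an iteration. The step `s (k + 1)` is any global minimizer of the sub-sampled cubic model
(`s 0` plays no role). -/
structure IsSCR {Ω : Type*} {mΩ : MeasurableSpace Ω} (μ : Measure Ω) (ℱ : Filtration ℕ mΩ)
    {d N : ℕ} (f : Fin N → EuclideanSpace ℝ (Fin d) → ℝ) (M : ℝ)
    (x₀ : EuclideanSpace ℝ (Fin d)) (x s : ℕ → Ω → EuclideanSpace ℝ (Fin d))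
    (ξg ξH : ℕ → Ω → Finset (Fin N)) : Prop where
  init : ∀ ω, x 0 ω = x₀
  isMinOn_step : ∀ k ω, IsMinOn
    (cubicModel (batchGradient f (ξg k ω) (x k ω)) (batchHessian f (ξH k ω) (x k ω)) M)
    Set.univ (s (k + 1) ω)
  update : ∀ k ω, x (k + 1) ω = x k ω + s (k + 1) ω
  measurable_iterate : ∀ k, Measurable[ℱ k] (x k)
  measurableSet_sample_gradient : ∀ k S, MeasurableSet[ℱ (k + 1)] {ω | ξg k ω = S}
  measurableSet_sample_hessian : ∀ k S, MeasurableSet[ℱ (k + 1)] {ω | ξH k ω = S}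
  sampling_gradient : ∀ k, IsSampledWithoutReplacement μ (ℱ k) (ξg k)
  sampling_hessian : ∀ k, IsSampledWithoutReplacement μ (ℱ k) (ξH k)

/-- The inexactness condition `‖g_k - ∇F(x_k)‖ ≤ C₁ ‖s_{k+1}‖²` for the mini-batch gradient at `x`
with index set `S` and step `s`. -/
def GradientInexact {d N : ℕ} (f : Fin N → EuclideanSpace ℝ (Fin d) → ℝ) (C₁ : ℝ)
    (S : Finset (Fin N)) (x s : EuclideanSpace ℝ (Fin d)) : Prop :=
  ‖batchGradient f S x - gradient (objective f) x‖ ≤ C₁ * ‖s‖ ^ 2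

/-- The inexactness condition `‖(H_k - ∇²F(x_k)) s_{k+1}‖ ≤ C₂ ‖s_{k+1}‖²` for the mini-batch
Hessian at `x` with index set `S` and step `s`. -/
def HessianInexact {d N : ℕ} (f : Fin N → EuclideanSpace ℝ (Fin d) → ℝ) (C₂ : ℝ)
    (S : Finset (Fin N)) (x s : EuclideanSpace ℝ (Fin d)) : Prop :=
  ‖(batchHessian f S x - hessian (objective f) x) s‖ ≤ C₂ * ‖s‖ ^ 2

/-- The sample size condition
`|S| ≥ (1/N + C₁² ‖x_{k+1} - x_k‖⁴ / (64 L₀² log (2(d+1)/ζ)))⁻¹`, with `x = x_k`, `x' = x_{k+1}`. -/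
def GradientSampleSize {d N : ℕ} (L₀ C₁ ζ : ℝ) (S : Finset (Fin N))
    (x x' : EuclideanSpace ℝ (Fin d)) : Prop :=
  (S.card : ℝ) ≥ (1 / (N : ℝ) + C₁ ^ 2 * ‖x' - x‖ ^ 4 /
    (64 * L₀ ^ 2 * Real.log (2 * ((d : ℝ) + 1) / ζ)))⁻¹

/-- The sample size condition
`|S| ≥ (1/N + C₂² ‖x_{k+1} - x_k‖² / (64 L₁² log (4d/ζ)))⁻¹`, with `x = x_k`, `x' = x_{k+1}`. -/
def HessianSampleSize {d N : ℕ} (L₁ C₂ ζ : ℝ) (S : Finset (Fin N))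
    (x x' : EuclideanSpace ℝ (Fin d)) : Prop :=
  (S.card : ℝ) ≥ (1 / (N : ℝ) + C₂ ^ 2 * ‖x' - x‖ ^ 2 /
    (64 * L₁ ^ 2 * Real.log (4 * (d : ℝ) / ζ)))⁻¹

end

end SubsampledCubic

/-! Removing a uniformly chosen element from a uniform batch of size `n + 1` leaves a uniform batch
of size `n`. The batch mean then moves by at most `2 L / (n + 1)`, and the move averages to zero
over the removed element. Batch means are thus a martingale as the size decreases from `N`, where
the deviation from the full mean is zero. Under a potential `Φ` as in `IsExpPotential` the linear
term averages out, so one removal multiplies the mean of `Φ (θ • deviation)` by at most `exp (12 θ²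
L² / (n + 1)²)`. These exponents telescope to a multiple of `1/n - 1/N` (`subsetMean_potential_le`),
and Markov's inequality gives the tail bound `card_deviating_le`.

Gradients use `exp √(1 + ‖y‖²)`, with the dimension-free value `e` at zero; Hessians use the trace
of `2 cosh`, with value `2 d` at zero. Its growth bound comes from scalar inequalities transferred
to pairs of spectra by `sum_eigenvalues_le`.

The step depends on the sampled batch, so conditioning on the sample size condition is not possible.
The deviation threshold therefore depends on the batch size alone; on the event where it is
respected, the sample size condition bounds the threshold deterministically
(`pos_and_le_of_inv_le`). -/

namespace SubsampledCubic

/-- A potential on a normed space that dominates `exp ‖·‖` and grows by at most a factor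
`exp (3 c²)`, up to a linear term, under perturbations of norm at most `c`. -/
structure IsExpPotential {E : Type*} [NormedAddCommGroup E] [NormedSpace ℝ E] (Φ : E → ℝ) :
    Prop where
  exp_norm_le : ∀ y, Real.exp ‖y‖ ≤ Φ y
  exists_linear_le : ∀ (y : E) (c : ℝ), 0 ≤ c → ∃ l : E →ₗ[ℝ] ℝ, ∀ z, ‖z‖ ≤ c →
    Φ (y + z) ≤ Real.exp (3 * c ^ 2) * Φ y + l z

/-! ### An exponential potential on inner product spaces -/

section Vector

theorem exp_le_add_exp_sq (x : ℝ) : Real.exp x ≤ x + Real.exp (x ^ 2) := by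
  have h2 := Real.add_one_le_exp (x ^ 2)
  rcases le_or_gt |x| 1 with h | h
  · have := abs_le.1 (Real.abs_exp_sub_one_sub_id_le h)
    linarith [this.2]
  · rcases lt_abs.1 h with h | h
    · have : Real.exp x ≤ Real.exp (x ^ 2) := Real.exp_le_exp.2 (by nlinarith)
      linarith
    · have : Real.exp x ≤ 1 := Real.exp_le_one_iff.2 (by linarith)
      nlinarith

theorem isExpPotential_exp_sqrt {V : Type*} [NormedAddCommGroup V] [InnerProductSpace ℝ V] :
    IsExpPotential fun y : V => Real.exp √(1 + ‖y‖ ^ 2) where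
  exp_norm_le y := Real.exp_le_exp.2 (Real.le_sqrt_of_sq_le (by linarith))
  exists_linear_le y c hc := by
    set g : ℝ := √(1 + ‖y‖ ^ 2) with hg
    have hg1 : 1 ≤ g := Real.one_le_sqrt.2 (by nlinarith [sq_nonneg ‖y‖])
    have hg0 : 0 < g := by linarith
    have hgsq : g ^ 2 = 1 + ‖y‖ ^ 2 := Real.sq_sqrt (by positivity)
    have hyg : ‖y‖ ≤ g := Real.le_sqrt_of_sq_le (by linarith)
    refine ⟨(Real.exp g * Real.exp (c ^ 2 / 2) * g⁻¹) • (innerₛₗ ℝ y), fun z hz => ?_⟩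
    have hz0 := norm_nonneg z
    set w : ℝ := ⟪y, z⟫ * g⁻¹ with hw
    have hwc : |w| ≤ c := by
      rw [hw, abs_mul, abs_inv, abs_of_pos hg0, ← div_eq_mul_inv, div_le_iff₀ hg0]
      calc |⟪y, z⟫| ≤ ‖y‖ * ‖z‖ := abs_real_inner_le_norm y z
        _ ≤ g * c := by gcongr
        _ = c * g := mul_comm _ _
    have hin : ⟪y, z⟫ = w * g := by rw [hw]; field_simp
    have hzc : ‖z‖ ^ 2 ≤ c ^ 2 := by gcongr
    -- Squaring the right side gives at least `g² + 2 g w + g c²`, and `g ≥ 1` is what makes `g c²`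
    -- cover `‖z‖²`; this is the role of the `1` under the root.
    have hle : √(1 + ‖y + z‖ ^ 2) ≤ g + w + c ^ 2 / 2 := by
      have hwc2 := abs_le.1 hwc
      have hpos : 0 ≤ g + w + c ^ 2 / 2 := by nlinarith [sq_nonneg (c - 1)]
      refine Real.sqrt_le_iff.2 ⟨hpos, ?_⟩
      rw [norm_add_sq_real, hin]
      nlinarith [sq_nonneg (w + c ^ 2 / 2), mul_le_mul_of_nonneg_right hg1 (sq_nonneg c)]
    have hw2 : w ^ 2 ≤ c ^ 2 := sq_le_sq' (abs_le.1 hwc).1 (abs_le.1 hwc).2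
    calc Real.exp √(1 + ‖y + z‖ ^ 2) ≤ Real.exp (g + w + c ^ 2 / 2) := Real.exp_le_exp.2 hle
      _ = Real.exp g * Real.exp (c ^ 2 / 2) * Real.exp w := by
          rw [← Real.exp_add, ← Real.exp_add]; ring_nf
      _ ≤ Real.exp g * Real.exp (c ^ 2 / 2) * (w + Real.exp (w ^ 2)) := by
          gcongr; exact exp_le_add_exp_sq w
      _ ≤ Real.exp g * Real.exp (c ^ 2 / 2) * (w + Real.exp (c ^ 2)) := by gcongr
      _ = Real.exp (c ^ 2 / 2 + c ^ 2) * Real.exp g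
          + Real.exp g * Real.exp (c ^ 2 / 2) * w := by rw [Real.exp_add]; ring
      _ ≤ Real.exp (3 * c ^ 2) * Real.exp g + Real.exp g * Real.exp (c ^ 2 / 2) * w := by
          gcongr; nlinarith [sq_nonneg c]
      _ = _ := by simp [hw]; ring

end Vector

/-! ### The trace of `2 cosh` as a potential on self-adjoint operators -/

section SelfAdjoint

variable {V : Type*} [NormedAddCommGroup V] [InnerProductSpace ℝ V] [FiniteDimensional ℝ V]

/-- Convexity bounds the left side by `exp b * (b - a)`; replacing `exp b` by `exp a` costs `(exp b
- exp a) * (b - a)`, which convexity makes quadratic. Each summand of the error involves only one of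
`a`, `b`, so it can be summed over one spectrum at a time. -/
theorem exp_sub_exp_le (a b : ℝ) :
    Real.exp b - Real.exp a ≤
      Real.exp a * (b - a) + (b - a) ^ 2 * (Real.exp a + Real.exp b) := by
  have h1 := Real.add_one_le_exp (a - b)
  have h2 := Real.add_one_le_exp (b - a)
  have e1 : Real.exp (a - b) * Real.exp b = Real.exp a := by rw [← Real.exp_add]; ring_nf
  have e2 : Real.exp (b - a) * Real.exp a = Real.exp b := by rw [← Real.exp_add]; ring_nf
  have pa := Real.exp_pos a
  have pb := Real.exp_pos b
  have k1 : Real.exp b * (a - b + 1) ≤ Real.exp a := by nlinarith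
  have k2 : Real.exp a * (b - a + 1) ≤ Real.exp b := by nlinarith
  rcases le_total a b with h | h
  · nlinarith [mul_nonneg (sub_nonneg.2 h) (sub_nonneg.2 k1),
      mul_nonneg (sq_nonneg (b - a)) pa.le]
  · nlinarith [mul_nonneg (sub_nonneg.2 h) (sub_nonneg.2 k2),
      mul_nonneg (sq_nonneg (b - a)) pb.le]

theorem cosh_sub_cosh_le (a b : ℝ) :
    Real.cosh b - Real.cosh a ≤
      Real.sinh a * (b - a) + (b - a) ^ 2 * (Real.cosh a + Real.cosh b) := by
  have h1 := exp_sub_exp_le a b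
  have h2 := exp_sub_exp_le (-a) (-b)
  rw [Real.cosh_eq, Real.cosh_eq, Real.sinh_eq]
  nlinarith

/-- This is `1 + t ≤ exp t` at `t = c + a - b`, averaged with its reflection. The term `-c * cosh b`
later absorbs `sinh b * (b - a)`, as `|sinh| ≤ cosh`. -/
theorem cosh_le_exp_mul_cosh_add (a b c : ℝ) :
    Real.cosh b ≤ Real.exp c * Real.cosh a + Real.sinh b * (b - a) - c * Real.cosh b := by
  have key : ∀ a b : ℝ, Real.exp b ≤ Real.exp c * Real.exp a + Real.exp b * (b - a - c) := by
    intro a b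
    have h1 := Real.add_one_le_exp (c + a - b)
    have e1 : Real.exp b * Real.exp (c + a - b) = Real.exp c * Real.exp a := by
      rw [← Real.exp_add, ← Real.exp_add]; ring_nf
    nlinarith [mul_le_mul_of_nonneg_left h1 (Real.exp_pos b).le]
  have h1 := key a b
  have h2 := key (-a) (-b)
  rw [Real.cosh_eq, Real.cosh_eq, Real.sinh_eq]
  nlinarith

theorem inner_eigenvectorBasis_sub {A B : V →ₗ[ℝ] V} (hA : A.IsSymmetric) (hB : B.IsSymmetric)
    (i j : Fin (Module.finrank ℝ V)) :
    ⟪hA.eigenvectorBasis rfl i, (B - A) (hB.eigenvectorBasis rfl j)⟫ =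
      (hB.eigenvalues rfl j - hA.eigenvalues rfl i) *
        ⟪hA.eigenvectorBasis rfl i, hB.eigenvectorBasis rfl j⟫ := by
  rw [LinearMap.sub_apply, inner_sub_right, ← hA, hA.apply_eigenvectorBasis,
    hB.apply_eigenvectorBasis, inner_smul_left, inner_smul_right]
  simp; ring

theorem isSymmetric_of_selfAdjoint (A : selfAdjoint.submodule ℝ (V →L[ℝ] V)) :
    ((A : V →L[ℝ] V) : V →ₗ[ℝ] V).IsSymmetric :=
  ContinuousLinearMap.isSelfAdjoint_iff_isSymmetric.1 A.2

/-- The trace of `2 cosh A` for a self-adjoint operator `A`. -/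
noncomputable def traceCosh (A : selfAdjoint.submodule ℝ (V →L[ℝ] V)) : ℝ :=
  ∑ i, 2 * Real.cosh ((isSymmetric_of_selfAdjoint A).eigenvalues rfl i)

/-- Comparison of the spectra of `A` and `B`: a scalar inequality between functions of `a` and `b`
of the given form may be evaluated at all pairs of eigenvalues, weighted by the squared inner
products of the eigenvectors, and summed. -/
theorem sum_eigenvalues_le {A B : V →L[ℝ] V} (hA : (A : V →ₗ[ℝ] V).IsSymmetric)
    (hB : (B : V →ₗ[ℝ] V).IsSymmetric) {p q r s t u : ℝ → ℝ}
    (h : ∀ a b, p b ≤ q a + r a * (b - a) + s b * (b - a) + (b - a) ^ 2 * (t a + u b)) :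
    ∑ j, p (hB.eigenvalues rfl j) ≤
      ∑ i, q (hA.eigenvalues rfl i)
      + ∑ i, r (hA.eigenvalues rfl i) *
          ⟪hA.eigenvectorBasis rfl i, (B - A) (hA.eigenvectorBasis rfl i)⟫
      + ∑ j, s (hB.eigenvalues rfl j) *
          ⟪hB.eigenvectorBasis rfl j, (B - A) (hB.eigenvectorBasis rfl j)⟫
      + ∑ i, t (hA.eigenvalues rfl i) * ‖(B - A) (hA.eigenvectorBasis rfl i)‖ ^ 2
      + ∑ j, u (hB.eigenvalues rfl j) * ‖(B - A) (hB.eigenvectorBasis rfl j)‖ ^ 2 := by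
  set e := hA.eigenvectorBasis rfl
  set g := hB.eigenvectorBasis rfl
  set a := hA.eigenvalues rfl
  set b := hB.eigenvalues rfl
  have hD : ((B - A : V →L[ℝ] V) : V →ₗ[ℝ] V).IsSymmetric := by
    simpa using hB.sub hA
  have hent : ∀ i j, ⟪e i, (B - A) (g j)⟫ = (b j - a i) * ⟪e i, g j⟫ :=
    fun i j => inner_eigenvectorBasis_sub hA hB i j
  have hent' : ∀ i j, ⟪(B - A) (e i), g j⟫ = (b j - a i) * ⟪e i, g j⟫ :=
    fun i j => (hD (e i) (g j)).trans (hent i j)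
  -- By Parseval the weights `⟪e i, g j⟫ ^ 2` are doubly stochastic. Since `B - A` has mixed entries
  -- `(b j - a i) * ⟪e i, g j⟫`, their first and second moments are diagonal entries and squared
  -- column norms of `B - A`.
  have h1 : ∀ i, ∑ j, ⟪e i, g j⟫ ^ 2 = 1 := fun i => by
    have := g.sum_inner_mul_inner (e i) (e i)
    simp only [real_inner_comm (e i) (g _), real_inner_self_eq_norm_sq, e.norm_eq_one] at this
    simpa [sq, real_inner_comm] using this
  have h2 : ∀ j, ∑ i, ⟪e i, g j⟫ ^ 2 = 1 := fun j => by
    have := e.sum_inner_mul_inner (g j) (g j)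
    simpa [sq, real_inner_comm] using this
  have h3 : ∀ i, ∑ j, (b j - a i) * ⟪e i, g j⟫ ^ 2 = ⟪e i, (B - A) (e i)⟫ := fun i => by
    rw [← g.sum_inner_mul_inner]
    refine Finset.sum_congr rfl fun j _ => ?_
    rw [real_inner_comm _ (g j), hent']; ring
  have h4 : ∀ j, ∑ i, (b j - a i) * ⟪e i, g j⟫ ^ 2 = ⟪g j, (B - A) (g j)⟫ := fun j => by
    rw [← e.sum_inner_mul_inner]
    refine Finset.sum_congr rfl fun i _ => ?_
    rw [hent, real_inner_comm]; ring
  have h5 : ∀ i, ∑ j, (b j - a i) ^ 2 * ⟪e i, g j⟫ ^ 2 = ‖(B - A) (e i)‖ ^ 2 := fun i => by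
    rw [← real_inner_self_eq_norm_sq, ← g.sum_inner_mul_inner]
    refine Finset.sum_congr rfl fun j _ => ?_
    rw [real_inner_comm _ (g j), hent']; ring
  have h6 : ∀ j, ∑ i, (b j - a i) ^ 2 * ⟪e i, g j⟫ ^ 2 = ‖(B - A) (g j)‖ ^ 2 := fun j => by
    rw [← real_inner_self_eq_norm_sq, ← e.sum_inner_mul_inner]
    refine Finset.sum_congr rfl fun i _ => ?_
    rw [real_inner_comm (e i), hent]; ring
  calc ∑ j, p (b j) = ∑ j, ∑ i, p (b j) * ⟪e i, g j⟫ ^ 2 := by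
        simp [← Finset.mul_sum, h2]
    _ ≤ ∑ j, ∑ i, (q (a i) + r (a i) * (b j - a i) + s (b j) * (b j - a i)
          + (b j - a i) ^ 2 * (t (a i) + u (b j))) * ⟪e i, g j⟫ ^ 2 := by
        gcongr with j _ i _
        exact h _ _
    _ = ∑ i, ∑ j, q (a i) * ⟪e i, g j⟫ ^ 2
        + ∑ i, ∑ j, r (a i) * ((b j - a i) * ⟪e i, g j⟫ ^ 2)
        + ∑ j, ∑ i, s (b j) * ((b j - a i) * ⟪e i, g j⟫ ^ 2)
        + ∑ i, ∑ j, t (a i) * ((b j - a i) ^ 2 * ⟪e i, g j⟫ ^ 2)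
        + ∑ j, ∑ i, u (b j) * ((b j - a i) ^ 2 * ⟪e i, g j⟫ ^ 2) := by
        rw [Finset.sum_comm (f := fun i j => q (a i) * ⟪e i, g j⟫ ^ 2),
          Finset.sum_comm (f := fun i j => r (a i) * ((b j - a i) * ⟪e i, g j⟫ ^ 2)),
          Finset.sum_comm (f := fun i j => t (a i) * ((b j - a i) ^ 2 * ⟪e i, g j⟫ ^ 2))]
        simp only [← Finset.sum_add_distrib]
        refine Finset.sum_congr rfl fun j _ => Finset.sum_congr rfl fun i _ => ?_
        ring
    _ = _ := by simp only [← Finset.mul_sum, h1, h3, h4, h5, h6, mul_one]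

theorem abs_inner_apply_le {V : Type*} [NormedAddCommGroup V] [InnerProductSpace ℝ V]
    (D : V →L[ℝ] V) {c : ℝ} (hD : ‖D‖ ≤ c) {v : V} (hv : ‖v‖ = 1) : |⟪v, D v⟫| ≤ c := by
  calc |⟪v, D v⟫| ≤ ‖v‖ * ‖D v‖ := abs_real_inner_le_norm _ _
    _ ≤ c := by simpa [hv] using D.le_of_opNorm_le hD v

theorem norm_apply_sq_le {V : Type*} [NormedAddCommGroup V] [InnerProductSpace ℝ V]
    (D : V →L[ℝ] V) {c : ℝ} (hD : ‖D‖ ≤ c) {v : V} (hv : ‖v‖ = 1) : ‖D v‖ ^ 2 ≤ c ^ 2 := by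
  have : ‖D v‖ ≤ c := by simpa [hv] using D.le_of_opNorm_le hD v
  gcongr

theorem traceCosh_add_le_of_small (A D : selfAdjoint.submodule ℝ (V →L[ℝ] V)) {c : ℝ}
    (hD : ‖D‖ ≤ c) :
    (1 - c ^ 2) * traceCosh (A + D) ≤ (1 + c ^ 2) * traceCosh A
      + 2 * ∑ i, Real.sinh ((isSymmetric_of_selfAdjoint A).eigenvalues rfl i) *
          ⟪(isSymmetric_of_selfAdjoint A).eigenvectorBasis rfl i,
            (D : V →L[ℝ] V) ((isSymmetric_of_selfAdjoint A).eigenvectorBasis rfl i)⟫ := by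
  have h := sum_eigenvalues_le (isSymmetric_of_selfAdjoint A) (isSymmetric_of_selfAdjoint (A + D))
    (p := Real.cosh) (q := Real.cosh) (r := Real.sinh) (s := 0) (t := Real.cosh) (u := Real.cosh)
    (fun a b => by have := cosh_sub_cosh_le a b; simp only [Pi.zero_apply]; linarith)
  have hsub : ((A + D : selfAdjoint.submodule ℝ (V →L[ℝ] V)) : V →L[ℝ] V) - A = D := by simp
  rw [hsub] at h
  have k1 : ∀ B : selfAdjoint.submodule ℝ (V →L[ℝ] V),
      ∑ i, Real.cosh ((isSymmetric_of_selfAdjoint B).eigenvalues rfl i) *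
        ‖(D : V →L[ℝ] V) ((isSymmetric_of_selfAdjoint B).eigenvectorBasis rfl i)‖ ^ 2
      ≤ c ^ 2 * ∑ i, Real.cosh ((isSymmetric_of_selfAdjoint B).eigenvalues rfl i) := by
    intro B
    rw [Finset.mul_sum]
    refine Finset.sum_le_sum fun i _ => ?_
    rw [mul_comm]
    exact mul_le_mul_of_nonneg_right
      (norm_apply_sq_le _ hD (OrthonormalBasis.norm_eq_one _ i)) (Real.cosh_pos _).le
  have kA := k1 A
  have kB := k1 (A + D)
  simp only [Pi.zero_apply, zero_mul, Finset.sum_const_zero, add_zero] at h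
  unfold traceCosh
  rw [← Finset.mul_sum, ← Finset.mul_sum]
  linarith

theorem traceCosh_add_le (A D : selfAdjoint.submodule ℝ (V →L[ℝ] V)) {c : ℝ} (hD : ‖D‖ ≤ c) :
    traceCosh (A + D) ≤ Real.exp c * traceCosh A := by
  have h := sum_eigenvalues_le (isSymmetric_of_selfAdjoint A) (isSymmetric_of_selfAdjoint (A + D))
    (p := fun b => Real.cosh b + c * Real.cosh b) (q := fun a => Real.exp c * Real.cosh a)
    (r := 0) (s := Real.sinh) (t := 0) (u := 0)
    (fun a b => by have := cosh_le_exp_mul_cosh_add a b c; simp only [Pi.zero_apply]; linarith)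
  have hsub : ((A + D : selfAdjoint.submodule ℝ (V →L[ℝ] V)) : V →L[ℝ] V) - A = D := by simp
  rw [hsub] at h
  have k : ∑ i, Real.sinh ((isSymmetric_of_selfAdjoint (A + D)).eigenvalues rfl i) *
        ⟪(isSymmetric_of_selfAdjoint (A + D)).eigenvectorBasis rfl i,
          (D : V →L[ℝ] V) ((isSymmetric_of_selfAdjoint (A + D)).eigenvectorBasis rfl i)⟫
      ≤ ∑ i, c * Real.cosh ((isSymmetric_of_selfAdjoint (A + D)).eigenvalues rfl i) := by
    refine Finset.sum_le_sum fun i _ => ?_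
    refine (le_abs_self _).trans ?_
    rw [abs_mul, mul_comm]
    refine mul_le_mul (abs_inner_apply_le _ hD (OrthonormalBasis.norm_eq_one _ i)) ?_
      (abs_nonneg _) ((norm_nonneg _).trans hD)
    rw [Real.abs_sinh, ← Real.cosh_abs]
    exact (Real.sinh_lt_cosh _).le
  simp only [Pi.zero_apply, zero_mul, Finset.sum_const_zero, add_zero, Finset.sum_add_distrib,
    ← Finset.mul_sum] at h k
  unfold traceCosh
  rw [← Finset.mul_sum, ← Finset.mul_sum]
  linarith

/-- The norm is attained by an eigenvalue of largest modulus, of either sign; `2 cosh` dominates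
`exp |·|`, and the other summands are positive. -/
theorem exp_norm_le_traceCosh [Nontrivial V] (A : selfAdjoint.submodule ℝ (V →L[ℝ] V)) :
    Real.exp ‖A‖ ≤ traceCosh A := by
  have hA := isSymmetric_of_selfAdjoint A
  set e := hA.eigenvectorBasis rfl with he
  set a := hA.eigenvalues rfl with ha
  have : Nonempty (Fin (Module.finrank ℝ V)) := ⟨⟨0, Module.finrank_pos⟩⟩
  obtain ⟨m, hm⟩ := Finite.exists_max fun i => |a i|
  have hnorm : ‖(A : V →L[ℝ] V)‖ ≤ |a m| := by
    refine ContinuousLinearMap.opNorm_le_bound _ (abs_nonneg _) fun v => ?_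
    refine le_of_sq_le_sq ?_ (by positivity)
    rw [mul_pow, ← real_inner_self_eq_norm_sq, ← real_inner_self_eq_norm_sq,
      ← e.sum_inner_mul_inner, ← e.sum_inner_mul_inner, Finset.mul_sum]
    refine Finset.sum_le_sum fun i _ => ?_
    have h1 : ⟪e i, (A : V →L[ℝ] V) v⟫ = a i * ⟪e i, v⟫ := by
      have := hA (e i) v
      rw [he, hA.apply_eigenvectorBasis, inner_smul_left] at this
      simpa using this.symm
    rw [real_inner_comm (e i), h1, real_inner_comm (e i) v, sq_abs]
    have h2 : a i ^ 2 ≤ a m ^ 2 := sq_le_sq.2 (hm i)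
    nlinarith [mul_le_mul_of_nonneg_right h2 (sq_nonneg ⟪e i, v⟫)]
  calc Real.exp ‖A‖ ≤ Real.exp |a m| := Real.exp_le_exp.2 hnorm
    _ ≤ 2 * Real.cosh (a m) := by
        rw [← Real.cosh_abs, Real.cosh_eq]; linarith [Real.exp_pos (-|a m|)]
    _ ≤ traceCosh A := Finset.single_le_sum (f := fun i => 2 * Real.cosh (a i))
        (fun i _ => by have := Real.cosh_pos (a i); positivity) (Finset.mem_univ m)

theorem isExpPotential_traceCosh [Nontrivial V] : IsExpPotential (traceCosh (V := V)) where
  exp_norm_le := exp_norm_le_traceCosh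
  exists_linear_le A c hc := by
    have hpos : 0 ≤ traceCosh A := (Real.exp_pos _).le.trans (exp_norm_le_traceCosh A)
    -- For small `c` the second-order bound can be divided by `1 - c²`. For large `c` the
    -- first-order factor `exp c` is already below `exp (3 c²)`, and no linear term is needed.
    rcases le_or_gt (c ^ 2) (1 / 2) with h | h
    · refine ⟨((1 - c ^ 2)⁻¹ * 2) • ∑ i,
        Real.sinh ((isSymmetric_of_selfAdjoint A).eigenvalues rfl i) •
        (innerₛₗ ℝ ((isSymmetric_of_selfAdjoint A).eigenvectorBasis rfl i) ∘ₗ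
          (LinearMap.applyₗ ((isSymmetric_of_selfAdjoint A).eigenvectorBasis rfl i)) ∘ₗ
          ContinuousLinearMap.coeLM ℝ ∘ₗ
          (selfAdjoint.submodule ℝ (V →L[ℝ] V)).subtype), fun D hD => ?_⟩
      have hc1 : 0 < 1 - c ^ 2 := by linarith
      have hs := traceCosh_add_le_of_small A D hD
      -- With `y = c²`, it suffices that `(1 - y) (1 + y)² ≥ 1`, that is `y (1 - y - y²) ≥ 0`, which
      -- holds for `0 ≤ y ≤ 1/2`.
      have hexp : 1 + c ^ 2 ≤ (1 - c ^ 2) * Real.exp (3 * c ^ 2) := by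
        have h3 : Real.exp (3 * c ^ 2) = Real.exp (c ^ 2) ^ 3 := by
          rw [← Real.exp_nat_mul]; norm_num
        have h4 : (1 + c ^ 2) ^ 3 ≤ Real.exp (c ^ 2) ^ 3 := by
          gcongr; linarith [Real.add_one_le_exp (c ^ 2)]
        rw [h3]
        refine le_trans ?_ (mul_le_mul_of_nonneg_left h4 hc1.le)
        have hx := sq_nonneg c
        set y := c ^ 2
        nlinarith [mul_nonneg hx (sub_nonneg.2 h), mul_nonneg (mul_nonneg hx hx) (sub_nonneg.2 h),
          mul_nonneg (mul_nonneg (mul_nonneg hx hx) hx) (sub_nonneg.2 h)]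
      have := mul_le_mul_of_nonneg_right hexp hpos
      refine le_of_mul_le_mul_left ?_ hc1
      refine hs.trans ?_
      rw [mul_add, ← mul_assoc]
      refine add_le_add this (le_of_eq ?_)
      simp [LinearMap.sum_apply]
      field_simp
    · refine ⟨0, fun D hD => ?_⟩
      have := traceCosh_add_le A D hD
      refine this.trans ?_
      simp only [LinearMap.zero_apply, add_zero]
      gcongr
      nlinarith

theorem traceCosh_zero : traceCosh (0 : selfAdjoint.submodule ℝ (V →L[ℝ] V)) =
    2 * Module.finrank ℝ V := by
  have : ∀ i, (isSymmetric_of_selfAdjoint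
      (0 : selfAdjoint.submodule ℝ (V →L[ℝ] V))).eigenvalues rfl i = 0 := by
    intro i
    have h := (isSymmetric_of_selfAdjoint
      (0 : selfAdjoint.submodule ℝ (V →L[ℝ] V))).apply_eigenvectorBasis rfl i
    have h' := congrArg norm h
    simpa [norm_smul] using h'.symm
  simp [traceCosh, this, mul_comm]

end SelfAdjoint

/-! ### Concentration of batch means over subsets of fixed size -/

section Combinatorics

/-- The average of `v` over a finite set. -/
noncomputable def batchMean {ι E : Type*} [NormedAddCommGroup E] [NormedSpace ℝ E] (v : ι → E)
    (S : Finset ι) : E :=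
  (S.card : ℝ)⁻¹ • ∑ i ∈ S, v i

variable {ι E : Type*} [NormedAddCommGroup E] [NormedSpace ℝ E]

theorem norm_batchMean_le {v : ι → E} {L : ℝ} (hL : 0 ≤ L) (hv : ∀ i, ‖v i‖ ≤ L) (S : Finset ι) :
    ‖batchMean v S‖ ≤ L := by
  rcases S.eq_empty_or_nonempty with rfl | hS
  · simpa [batchMean] using hL
  have hc : (0 : ℝ) < S.card := by exact_mod_cast hS.card_pos
  rw [batchMean, norm_smul, norm_inv, Real.norm_natCast, inv_mul_le_iff₀ hc, ← nsmul_eq_mul]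
  exact norm_sum_le_of_le S (fun i _ => hv i) |>.trans (by simp)

variable [DecidableEq ι]

theorem batchMean_erase_sub {v : ι → E} {S : Finset ι} {i : ι} (hi : i ∈ S) (hS : 2 ≤ S.card) :
    batchMean v (S.erase i) - batchMean v S = (S.card : ℝ)⁻¹ • (batchMean v (S.erase i) - v i) := by
  have h1 : ∑ j ∈ S, v j = (((S.card : ℝ) - 1) • batchMean v (S.erase i)) + v i := by
    have hc : ((S.erase i).card : ℝ) = (S.card : ℝ) - 1 := by
      rw [Finset.card_erase_of_mem hi, Nat.cast_sub (by omega)]; simp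
    have hne : (S.card : ℝ) - 1 ≠ 0 := by
      have : (2 : ℝ) ≤ S.card := by exact_mod_cast hS
      linarith
    rw [batchMean, hc, smul_inv_smul₀ hne, Finset.sum_erase_add _ _ hi]
  have hne : (S.card : ℝ) ≠ 0 := by
    have : (2 : ℝ) ≤ S.card := by exact_mod_cast hS
    linarith
  have h2 : batchMean v S = (S.card : ℝ)⁻¹ • ((((S.card : ℝ) - 1) • batchMean v (S.erase i)) + v i) :=
    by rw [← h1]; rfl
  rw [h2]
  match_scalars <;> field_simp
  ring

theorem sum_batchMean_erase_sub {v : ι → E} {S : Finset ι} (hS : 2 ≤ S.card) :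
    ∑ i ∈ S, (batchMean v (S.erase i) - batchMean v S) = 0 := by
  have hS' : (2 : ℝ) ≤ S.card := by exact_mod_cast hS
  have hne : (S.card : ℝ) ≠ 0 := by linarith
  have hne1 : (S.card : ℝ) - 1 ≠ 0 := by linarith
  have h1 : ∀ i ∈ S, batchMean v (S.erase i) = ((S.card : ℝ) - 1)⁻¹ • (∑ j ∈ S, v j - v i) := by
    intro i hi
    rw [batchMean, Finset.card_erase_of_mem hi, Nat.cast_sub (by omega), Nat.cast_one,
      Finset.sum_erase_eq_sub hi]
  rw [Finset.sum_sub_distrib, Finset.sum_congr rfl h1, ← Finset.smul_sum, Finset.sum_sub_distrib,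
    Finset.sum_const, Finset.sum_const, batchMean, ← Nat.cast_smul_eq_nsmul ℝ,
    ← Nat.cast_smul_eq_nsmul ℝ, smul_inv_smul₀ hne]
  match_scalars
  field_simp
  ring

/-- Double counting: a pair `(T, i)` with `i ∈ T` corresponds to `(T.erase i, i)`, and each `S` of
size `n` has `Fintype.card ι - n` elements outside it. -/
theorem sum_powersetCard_succ_sum_erase [Fintype ι] (g : Finset ι → ℝ) (n : ℕ) :
    ∑ T ∈ Finset.powersetCard (n + 1) Finset.univ, ∑ i ∈ T, g (T.erase i) =
      (Fintype.card ι - n : ℕ) * ∑ S ∈ Finset.powersetCard n (Finset.univ : Finset ι), g S := by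
  have h : ∑ S ∈ Finset.powersetCard n (Finset.univ : Finset ι), ∑ _i ∈ Sᶜ, g S =
      (Fintype.card ι - n : ℕ) * ∑ S ∈ Finset.powersetCard n (Finset.univ : Finset ι), g S := by
    rw [Finset.mul_sum]
    refine Finset.sum_congr rfl fun S hS => ?_
    rw [Finset.sum_const, Finset.card_compl, (Finset.mem_powersetCard.1 hS).2, nsmul_eq_mul]
  rw [← h, Finset.sum_sigma', Finset.sum_sigma']
  refine Finset.sum_bij' (fun p _ => ⟨p.1.erase p.2, p.2⟩) (fun p _ => ⟨insert p.2 p.1, p.2⟩)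
    ?_ ?_ ?_ ?_ ?_
  · rintro ⟨T, i⟩ hp
    simp only [Finset.mem_sigma, Finset.mem_powersetCard, Finset.subset_univ, true_and,
      Finset.mem_compl] at hp ⊢
    refine ⟨by rw [Finset.card_erase_of_mem hp.2, hp.1]; rfl, Finset.notMem_erase _ _⟩
  · rintro ⟨S, i⟩ hp
    simp only [Finset.mem_sigma, Finset.mem_powersetCard, Finset.subset_univ, true_and,
      Finset.mem_compl] at hp ⊢
    exact ⟨by rw [Finset.card_insert_of_notMem hp.2, hp.1], Finset.mem_insert_self _ _⟩
  · rintro ⟨T, i⟩ hp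
    simp only [Finset.mem_sigma] at hp
    simp [Finset.insert_erase hp.2]
  · rintro ⟨S, i⟩ hp
    simp only [Finset.mem_sigma, Finset.mem_compl] at hp
    simp [Finset.erase_insert hp.2]
  · rintro ⟨T, i⟩ hp
    rfl

/-- The mean of `g` over all subsets with `n` elements. -/
noncomputable def subsetMean [Fintype ι] (g : Finset ι → ℝ) (n : ℕ) : ℝ :=
  ((Fintype.card ι).choose n : ℝ)⁻¹ * ∑ S ∈ Finset.powersetCard n (Finset.univ : Finset ι), g S

theorem subsetMean_le_of_erase [Fintype ι] {g : Finset ι → ℝ} {n : ℕ} (hn : n < Fintype.card ι)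
    {K : ℝ} (h : ∀ T : Finset ι, T.card = n + 1 → ∑ i ∈ T, g (T.erase i) ≤ T.card * (K * g T)) :
    subsetMean g n ≤ K * subsetMean g (n + 1) := by
  have h1 := sum_powersetCard_succ_sum_erase g n
  have hch := Nat.choose_succ_right_eq (Fintype.card ι) n
  have hch' : ((Fintype.card ι).choose (n + 1) : ℝ) * ((n + 1 : ℕ) : ℝ) =
      (Fintype.card ι).choose n * ((Fintype.card ι - n : ℕ) : ℝ) := by exact_mod_cast hch
  have p1 : (0 : ℝ) < (Fintype.card ι).choose n := by exact_mod_cast Nat.choose_pos hn.le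
  have p2 : (0 : ℝ) < (Fintype.card ι).choose (n + 1) := by exact_mod_cast Nat.choose_pos hn
  have p3 : (0 : ℝ) < ((Fintype.card ι - n : ℕ) : ℝ) := by
    exact_mod_cast Nat.sub_pos_of_lt hn
  have p4 : (0 : ℝ) < ((n + 1 : ℕ) : ℝ) := by positivity
  have h2 : ∑ T ∈ Finset.powersetCard (n + 1) (Finset.univ : Finset ι), ∑ i ∈ T, g (T.erase i) ≤
      ((n + 1 : ℕ) : ℝ) * (K * ∑ T ∈ Finset.powersetCard (n + 1) (Finset.univ : Finset ι), g T) := by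
    rw [Finset.mul_sum, Finset.mul_sum]
    refine Finset.sum_le_sum fun T hT => ?_
    have := h T (Finset.mem_powersetCard.1 hT).2
    rwa [(Finset.mem_powersetCard.1 hT).2] at this
  rw [h1] at h2
  unfold subsetMean
  set X := ∑ S ∈ Finset.powersetCard n (Finset.univ : Finset ι), g S
  set Y := ∑ S ∈ Finset.powersetCard (n + 1) (Finset.univ : Finset ι), g S
  rw [inv_mul_le_iff₀ p1]
  refine le_of_mul_le_mul_left (h2.trans (le_of_eq ?_)) p3
  calc _ = (((Fintype.card ι).choose (n + 1) : ℝ) * ((n + 1 : ℕ) : ℝ)) *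
        (((Fintype.card ι).choose (n + 1) : ℝ)⁻¹ * (K * Y)) := by field_simp
    _ = _ := by rw [hch']; ring

theorem subsetMean_potential_le [Fintype ι] {Φ : E → ℝ} (hΦ : IsExpPotential Φ) {v : ι → E} {L : ℝ}
    (hL : 0 ≤ L) (hv : ∀ i, ‖v i‖ ≤ L) {θ : ℝ} (hθ : 0 ≤ θ) {n : ℕ} (hn : 0 < n)
    (hnN : n ≤ Fintype.card ι) :
    subsetMean (fun S => Φ (θ • (batchMean v S - batchMean v Finset.univ))) n ≤
      Real.exp (12 * θ ^ 2 * L ^ 2 * ((n : ℝ)⁻¹ - (Fintype.card ι : ℝ)⁻¹)) * Φ 0 := by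
  induction hnN using Nat.decreasingInduction with
  | self =>
    simp [subsetMean, ← Finset.card_univ]
  | of_succ n hnN ih =>
    specialize ih n.succ_pos
    have hn' : (0 : ℝ) < n := by exact_mod_cast hn
    have hstep : subsetMean (fun S => Φ (θ • (batchMean v S - batchMean v Finset.univ))) n ≤
        Real.exp (3 * (θ * (2 * L / (n + 1 : ℕ))) ^ 2) *
        subsetMean (fun S => Φ (θ • (batchMean v S - batchMean v Finset.univ))) (n + 1) := by
      refine subsetMean_le_of_erase hnN fun T hT => ?_
      obtain ⟨l, hl⟩ := hΦ.exists_linear_le (θ • (batchMean v T - batchMean v Finset.univ))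
        (θ * (2 * L / (n + 1 : ℕ))) (by positivity)
      have hT2 : 2 ≤ T.card := by omega
      have hb : ∀ i ∈ T, Φ (θ • (batchMean v (T.erase i) - batchMean v Finset.univ)) ≤
          Real.exp (3 * (θ * (2 * L / (n + 1 : ℕ))) ^ 2) *
            Φ (θ • (batchMean v T - batchMean v Finset.univ)) +
          l (θ • (batchMean v (T.erase i) - batchMean v T)) := by
        intro i hi
        have hnorm : ‖θ • (batchMean v (T.erase i) - batchMean v T)‖ ≤
            θ * (2 * L / (n + 1 : ℕ)) := by
          rw [batchMean_erase_sub hi hT2, norm_smul, norm_smul, Real.norm_of_nonneg hθ, hT,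
            norm_inv, Real.norm_natCast, inv_mul_eq_div]
          gcongr
          refine (norm_sub_le _ _).trans ?_
          linarith [norm_batchMean_le hL hv (T.erase i), hv i]
        have := hl _ hnorm
        rwa [← smul_add, sub_add_sub_cancel'] at this
      refine (Finset.sum_le_sum hb).trans (le_of_eq ?_)
      rw [Finset.sum_add_distrib, Finset.sum_const, nsmul_eq_mul, ← map_sum, ← Finset.smul_sum,
        sum_batchMean_erase_sub hT2]
      simp
    have hΦ0 : 0 ≤ Φ 0 := (Real.exp_pos _).le.trans (hΦ.exp_norm_le 0)
    refine (hstep.trans (mul_le_mul_of_nonneg_left ih (Real.exp_pos _).le)).trans ?_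
    rw [← mul_assoc, ← Real.exp_add]
    gcongr
    -- The right side is `1 / (n (n + 1))`; this is the telescoping.
    have hk : ((n + 1 : ℕ) : ℝ)⁻¹ ^ 2 ≤ (n : ℝ)⁻¹ - ((n + 1 : ℕ) : ℝ)⁻¹ := by
      push_cast
      rw [inv_sub_inv (by positivity) (by positivity), inv_pow, inv_eq_one_div,
        div_le_div_iff₀ (by positivity) (by positivity)]
      nlinarith
    have hk2 := mul_le_mul_of_nonneg_left hk (show 0 ≤ 12 * θ ^ 2 * L ^ 2 by positivity)
    have e : 3 * (θ * (2 * L / (n + 1 : ℕ))) ^ 2 =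
        12 * θ ^ 2 * L ^ 2 * ((n + 1 : ℕ) : ℝ)⁻¹ ^ 2 := by
      rw [div_eq_mul_inv]; ring
    rw [e]
    linarith

open Classical in
/-- The proportion of batches of size `n` whose mean deviates from the full mean by more than
`8 L √(ℓ (1/n - 1/N))` is at most `Φ 0 * exp (-ℓ)`. -/
theorem card_deviating_le [Fintype ι] {Φ : E → ℝ} (hΦ : IsExpPotential Φ) {v : ι → E} {L : ℝ}
    (hL : 0 < L) (hv : ∀ i, ‖v i‖ ≤ L) {r : ℝ} (hr : 0 < r) {n : ℕ} (hn : 0 < n)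
    (hnN : n ≤ Fintype.card ι) :
    ((Fintype.card ι).choose n : ℝ)⁻¹ *
      ((Finset.powersetCard n Finset.univ).filter fun S : Finset ι =>
        8 * L * √(r * ((n : ℝ)⁻¹ - (Fintype.card ι : ℝ)⁻¹)) <
          ‖batchMean v S - batchMean v Finset.univ‖).card ≤ Φ 0 * Real.exp (-r) := by
  have hΦ0 : 0 ≤ Φ 0 := (Real.exp_pos _).le.trans (hΦ.exp_norm_le 0)
  have hn' : (0 : ℝ) < n := by exact_mod_cast hn
  -- The full batch has no deviation. It is split off because `θ` below divides by `1/n - 1/N`.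
  rcases hnN.eq_or_lt with rfl | hlt
  · rw [Finset.filter_eq_empty_iff.2]
    · simp; positivity
    · intro S hS
      rw [← Finset.card_univ, Finset.powersetCard_self, Finset.mem_singleton] at hS
      simp [hS]
  set δ : ℝ := (n : ℝ)⁻¹ - (Fintype.card ι : ℝ)⁻¹ with hδ
  have hδ0 : 0 < δ := by
    have : (n : ℝ) < Fintype.card ι := by exact_mod_cast hlt
    exact sub_pos.2 (inv_strictAnti₀ hn' this)
  -- This choice gives growth exponent `3 r` and makes `θ` times the threshold `4 r`, so Markov's
  -- inequality leaves `exp (-r)`.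
  set θ : ℝ := √(r / δ) / (2 * L) with hθ
  have hθ0 : 0 < θ := by positivity
  have hθ2 : 12 * θ ^ 2 * L ^ 2 * δ = 3 * r := by
    rw [hθ, div_pow, Real.sq_sqrt (by positivity)]; field_simp; ring
  have hθt : θ * (8 * L * √(r * δ)) = 4 * r := by
    have : √(r / δ) * √(r * δ) = r := by
      rw [← Real.sqrt_mul (by positivity), show r / δ * (r * δ) = r ^ 2 by field_simp,
        Real.sqrt_sq hr.le]
    rw [hθ]
    calc _ = 4 * (√(r / δ) * √(r * δ)) := by field_simp; ring
      _ = 4 * r := by rw [this]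
  have hmean := subsetMean_potential_le hΦ hL.le hv hθ0.le hn hlt.le
  rw [← hδ, hθ2] at hmean
  have hp : (0 : ℝ) < (Fintype.card ι).choose n := by exact_mod_cast Nat.choose_pos hlt.le
  have hcard : (((Finset.powersetCard n Finset.univ).filter fun S : Finset ι =>
        8 * L * √(r * δ) < ‖batchMean v S - batchMean v Finset.univ‖).card : ℝ) *
        Real.exp (4 * r) ≤ ∑ S ∈ Finset.powersetCard n (Finset.univ : Finset ι),
          Φ (θ • (batchMean v S - batchMean v Finset.univ)) := by
    rw [← nsmul_eq_mul]
    refine (Finset.card_nsmul_le_sum _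
      (fun S => Φ (θ • (batchMean v S - batchMean v Finset.univ))) _ fun S hS => ?_).trans ?_
    · refine le_trans (Real.exp_le_exp.2 ?_) (hΦ.exp_norm_le _)
      rw [← hθt, norm_smul, Real.norm_of_nonneg hθ0.le]
      exact mul_le_mul_of_nonneg_left (Finset.mem_filter.1 hS).2.le hθ0.le
    · exact Finset.sum_le_sum_of_subset_of_nonneg (Finset.filter_subset _ _) fun S _ _ =>
        (Real.exp_pos _).le.trans (hΦ.exp_norm_le _)
  refine le_of_mul_le_mul_right ?_ (Real.exp_pos (4 * r))
  rw [mul_assoc]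
  refine (mul_le_mul_of_nonneg_left hcard (inv_pos.2 hp).le).trans (hmean.trans (le_of_eq ?_))
  rw [mul_assoc, ← Real.exp_add, mul_comm]
  ring_nf

end Combinatorics

/-! ### From counting batches to probabilities under conditional sampling -/

section Sampling

theorem le_measureReal_of_ae_of_imp {Ω : Type*} {mΩ : MeasurableSpace Ω} {μ : Measure Ω}
    {p q : Ω → Prop} {a : ℝ} (h : a ≤ μ.real {ω | p ω → q ω})
    (hp : ∀ᵐ ω ∂μ, p ω) : a ≤ μ.real {ω | q ω} := by
  refine h.trans (le_of_eq (measureReal_congr ?_))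
  filter_upwards [hp] with ω hω
  exact propext ⟨fun h => h hω, fun h _ => h⟩

variable {Ω : Type*} {mΩ : MeasurableSpace Ω} {μ : Measure Ω} [IsProbabilityMeasure μ]
  {𝒢 : MeasurableSpace Ω} {N : ℕ} {ξ : Ω → Finset (Fin N)}

open Classical in
/-- If for every state of the past at most a fraction `ζ` of the batches of each size is bad, then
the sampled batch is bad with probability at most `ζ`. -/
theorem IsSampledWithoutReplacement.measureReal_mem_le
    (hξ : IsSampledWithoutReplacement μ 𝒢 ξ) (h𝒢 : 𝒢 ≤ mΩ) {B : Finset (Fin N) → Set Ω}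
    (hB : ∀ S, MeasurableSet[𝒢] (B S)) {ζ : ℝ}
    (hcount : ∀ ω n, n ≤ N → (N.choose n : ℝ)⁻¹ *
      ((Finset.powersetCard n Finset.univ).filter fun S => ω ∈ B S).card ≤ ζ) :
    μ.real {ω | ω ∈ B (ξ ω)} ≤ ζ := by
  set c : Finset (Fin N) → Ω → ℝ :=
    fun S ω => if S.card = (ξ ω).card then ((N.choose (ξ ω).card : ℕ) : ℝ)⁻¹ else 0 with hc
  have hint : ∀ S, Integrable (c S) μ := fun S =>
    integrable_condExp.congr (hξ.uniform S)
  -- `B S` belongs to the past, so the defining property of conditional expectation applies on it.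
  have hterm : ∀ S, μ.real ({ω | ξ ω = S} ∩ B S) = ∫ ω, (B S).indicator (c S) ω ∂μ := by
    intro S
    have hBm : MeasurableSet[mΩ] (B S) := h𝒢 _ (hB S)
    rw [integral_indicator hBm, ← setIntegral_congr_ae hBm ((hξ.uniform S).mono fun ω h _ => h),
      setIntegral_condExp h𝒢 ((integrable_const 1).indicator (hξ.measurableSet_eq S)) (hB S),
      integral_indicator (hξ.measurableSet_eq S), integral_const, smul_eq_mul, mul_one,
      measureReal_restrict_apply MeasurableSet.univ, Set.univ_inter,
      measureReal_restrict_apply (hξ.measurableSet_eq S)]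
  have hsub : {ω | ω ∈ B (ξ ω)} ⊆ ⋃ S ∈ (Finset.univ : Finset (Finset (Fin N))),
      ({ω | ξ ω = S} ∩ B S) := by
    intro ω hω
    simpa using hω
  calc μ.real {ω | ω ∈ B (ξ ω)}
      ≤ μ.real (⋃ S ∈ (Finset.univ : Finset (Finset (Fin N))), ({ω | ξ ω = S} ∩ B S)) :=
        measureReal_mono hsub
    _ ≤ ∑ S, μ.real ({ω | ξ ω = S} ∩ B S) := measureReal_biUnion_finset_le _ _
    _ = ∫ ω, ∑ S, (B S).indicator (c S) ω ∂μ := by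
        rw [integral_finsetSum]
        · exact Finset.sum_congr rfl fun S _ => hterm S
        · exact fun S _ => (hint S).indicator (h𝒢 _ (hB S))
    _ ≤ ∫ _ω, ζ ∂μ := by
        refine integral_mono
          (integrable_finsetSum _ fun S _ => (hint S).indicator (h𝒢 _ (hB S)))
          (integrable_const ζ) fun ω => ?_
        have hcard : (ξ ω).card ≤ N := by simpa using (ξ ω).card_le_univ
        refine le_trans (le_of_eq ?_) (hcount ω _ hcard)
        rw [mul_comm, ← nsmul_eq_mul, ← Finset.sum_const, Finset.sum_filter,
          Finset.powersetCard_eq_filter, Finset.powerset_univ, Finset.sum_filter]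
        refine Finset.sum_congr rfl fun S _ => ?_
        simp only [hc, Set.indicator_apply]
        split_ifs <;> rfl
    _ = ζ := by simp

theorem IsSampledWithoutReplacement.measureReal_norm_batchMean_sub_le
    {V E : Type*} [TopologicalSpace V] [MeasurableSpace V] [BorelSpace V]
    [NormedAddCommGroup E] [NormedSpace ℝ E]
    {Φ : E → ℝ} (hΦ : IsExpPotential Φ) (hξ : IsSampledWithoutReplacement μ 𝒢 ξ) (h𝒢 : 𝒢 ≤ mΩ)
    {X : Ω → V} (hX : Measurable[𝒢] X) {v : Fin N → V → E} (hvc : ∀ i, Continuous (v i))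
    {L : ℝ} (hL : 0 < L) (hv : ∀ i y, ‖v i y‖ ≤ L) {r : ℝ} (hr : 0 < r) :
    1 - Φ 0 * Real.exp (-r) ≤ μ.real {ω | 0 < (ξ ω).card →
      ‖batchMean (fun i => v i (X ω)) (ξ ω) - batchMean (fun i => v i (X ω)) Finset.univ‖ ≤
        8 * L * √(r * (((ξ ω).card : ℝ)⁻¹ - (N : ℝ)⁻¹))} := by
  classical
  have hΦ0 : 0 ≤ Φ 0 := (Real.exp_pos _).le.trans (hΦ.exp_norm_le 0)
  -- For a fixed `S`, badness depends only on the past state `X`. Empty batches never count as bad.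
  set B : Finset (Fin N) → Set Ω := fun S => X ⁻¹' {y | 0 < S.card ∧
    8 * L * √(r * ((S.card : ℝ)⁻¹ - (N : ℝ)⁻¹)) <
      ‖batchMean (fun i => v i y) S - batchMean (fun i => v i y) Finset.univ‖} with hBdef
  have hcont : ∀ S, Continuous fun y => batchMean (fun i => v i y) S := fun S =>
    (continuous_finsetSum S fun i _ => hvc i).const_smul _
  have hB : ∀ S, MeasurableSet[𝒢] (B S) := fun S =>
    hX ((MeasurableSet.const _).inter
      (isOpen_lt continuous_const ((hcont S).sub (hcont _)).norm).measurableSet)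
  have key := hξ.measureReal_mem_le h𝒢 hB (ζ := Φ 0 * Real.exp (-r)) fun ω n hn => by
    rcases Nat.eq_zero_or_pos n with rfl | hn0
    · rw [Finset.filter_eq_empty_iff.2]
      · simp; positivity
      · intro S hS
        have := (Finset.mem_powersetCard.1 hS).2
        simp [hBdef, this, -Finset.card_pos]
    · have h := card_deviating_le hΦ (v := fun i => v i (X ω)) hL (fun i => hv i _) hr hn0
        (by simpa using hn)
      simp only [Fintype.card_fin] at h
      refine le_trans (le_of_eq ?_) h
      congr 3
      refine Finset.filter_congr fun S hS => ?_
      have := (Finset.mem_powersetCard.1 hS).2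
      simp [hBdef, this, hn0, -Finset.card_pos]
  have hun : (1 : ℝ) ≤ μ.real {ω | 0 < (ξ ω).card →
      ‖batchMean (fun i => v i (X ω)) (ξ ω) - batchMean (fun i => v i (X ω)) Finset.univ‖ ≤
        8 * L * √(r * (((ξ ω).card : ℝ)⁻¹ - (N : ℝ)⁻¹))} + μ.real {ω | ω ∈ B (ξ ω)} := by
    refine le_trans (le_of_eq ?_) (measureReal_union_le _ _)
    rw [← probReal_univ (μ := μ)]
    congr 1
    refine (Set.eq_univ_of_forall fun ω => ?_).symm
    simp only [hBdef, Set.mem_union, Set.mem_ofPred_eq, Set.mem_preimage]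
    by_cases h : 0 < (ξ ω).card
    · simpa [h] using le_or_gt _ _
    · simp [h]
  linarith

/-- The sample size condition is the threshold inequality solved for `n`, with `64 = 8²`. Its right
side is positive, which excludes the empty batch. -/
theorem pos_and_le_of_inv_le {n : ℕ} (hN : 0 < N) {L r q : ℝ} (hL : 0 < L) (hr : 0 < r)
    (hq : 0 ≤ q) (h : (n : ℝ) ≥ (1 / (N : ℝ) + q ^ 2 / (64 * L ^ 2 * r))⁻¹) :
    0 < n ∧ 8 * L * √(r * ((n : ℝ)⁻¹ - (N : ℝ)⁻¹)) ≤ q := by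
  have hN' : (0 : ℝ) < N := by exact_mod_cast hN
  have hpos : 0 < 1 / (N : ℝ) + q ^ 2 / (64 * L ^ 2 * r) := by positivity
  have hn : (0 : ℝ) < n := (inv_pos.2 hpos).trans_le h
  refine ⟨by exact_mod_cast hn, ?_⟩
  have h1 : (n : ℝ)⁻¹ - (N : ℝ)⁻¹ ≤ q ^ 2 / (64 * L ^ 2 * r) := by
    have := inv_le_of_inv_le₀ hpos h
    rw [one_div] at this
    linarith
  rw [le_div_iff₀ (by positivity)] at h1
  have h2 : √(r * ((n : ℝ)⁻¹ - (N : ℝ)⁻¹)) ≤ q / (8 * L) := by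
    refine Real.sqrt_le_iff.2 ⟨by positivity, ?_⟩
    rw [div_pow, le_div_iff₀ (by positivity)]
    linarith
  rwa [le_div_iff₀ (by positivity), mul_comm] at h2

end Sampling

/-! ### Gradients and Hessians of the components and of their average -/

section Derivatives

variable {d N : ℕ}

theorem norm_gradient_le_of_lipschitzWith {f : EuclideanSpace ℝ (Fin d) → ℝ} {L : ℝ≥0}
    (hf : LipschitzWith L f) (x : EuclideanSpace ℝ (Fin d)) : ‖gradient f x‖ ≤ L := by
  rw [gradient, LinearIsometryEquiv.norm_map]
  exact norm_fderiv_le_of_lipschitz ℝ hf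

theorem isSelfAdjoint_hessian {f : EuclideanSpace ℝ (Fin d) → ℝ} (hf : Differentiable ℝ f)
    {x : EuclideanSpace ℝ (Fin d)} (hx : DifferentiableAt ℝ (gradient f) x) :
    IsSelfAdjoint (hessian f x) := by
  rw [ContinuousLinearMap.isSelfAdjoint_iff_isSymmetric]
  set J : EuclideanSpace ℝ (Fin d) →L[ℝ] EuclideanSpace ℝ (Fin d) →L[ℝ] ℝ :=
    (isBoundedBilinearMap_inner (𝕜 := ℝ) (E := EuclideanSpace ℝ (Fin d))).toContinuousLinearMap
    with hJ
  have hJa : ∀ y z, J y z = ⟪y, z⟫ := fun _ _ => rfl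
  have h1 : ∀ y, HasFDerivAt f (J (gradient f y)) y := by
    exact fun y => (hf y).hasGradientAt.hasFDerivAt.congr_fderiv (by ext z; rfl)
  have h2 : HasFDerivAt (fun y => J (gradient f y)) (J ∘L hessian f x) x :=
    J.hasFDerivAt.comp x hx.hasFDerivAt
  intro v w
  have := second_derivative_symmetric h1 h2 v w
  simp only [ContinuousLinearMap.comp_apply, hJa] at this
  simpa [real_inner_comm] using this

theorem hasGradientAt_objective {f : Fin N → EuclideanSpace ℝ (Fin d) → ℝ}
    (hf : ∀ i, Differentiable ℝ (f i)) (x : EuclideanSpace ℝ (Fin d)) :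
    HasGradientAt (objective f) (batchGradient f Finset.univ x) x := by
  rw [hasGradientAt_iff_hasFDerivAt]
  have h : HasFDerivAt (objective f)
      ((N : ℝ)⁻¹ • ∑ i, InnerProductSpace.toDual ℝ _ (gradient (f i) x)) x :=
    (HasFDerivAt.fun_sum fun i _ => (hf i x).hasGradientAt.hasFDerivAt).const_smul (N : ℝ)⁻¹
  refine h.congr_fderiv ?_
  ext v
  simp [batchGradient]

theorem gradient_objective {f : Fin N → EuclideanSpace ℝ (Fin d) → ℝ}
    (hf : ∀ i, Differentiable ℝ (f i)) :
    gradient (objective f) = batchGradient f Finset.univ :=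
  funext fun x => (hasGradientAt_objective hf x).gradient

theorem hessian_objective {f : Fin N → EuclideanSpace ℝ (Fin d) → ℝ}
    (hf : ∀ i, Differentiable ℝ (f i)) (hf' : ∀ i, Differentiable ℝ (gradient (f i)))
    (x : EuclideanSpace ℝ (Fin d)) :
    hessian (objective f) x = batchHessian f Finset.univ x := by
  rw [hessian, gradient_objective hf]
  have h : HasFDerivAt (batchGradient f Finset.univ) (batchHessian f Finset.univ x) x :=
    ((HasFDerivAt.fun_sum (u := Finset.univ) fun i _ => (hf' i x).hasFDerivAt).fun_const_smul
      (N : ℝ)⁻¹).congr_fderiv (by simp [batchHessian, hessian])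
      |>.congr_of_eventuallyEq (Filter.Eventually.of_forall fun y => by simp [batchGradient])
  exact h.fderiv

end Derivatives

/-! ### The two inexactness bounds -/

section Inexactness

variable {Ω : Type*} {mΩ : MeasurableSpace Ω} {μ : Measure Ω} [IsProbabilityMeasure μ]
  {𝒢 : MeasurableSpace Ω} {d N : ℕ} {f : Fin N → EuclideanSpace ℝ (Fin d) → ℝ} {L₀ L₁ L₂ : ℝ≥0}
  {x x' s : Ω → EuclideanSpace ℝ (Fin d)} {ξ : Ω → Finset (Fin N)}

theorem measureReal_gradientInexact_ge (h𝒢 : 𝒢 ≤ mΩ) (hd : 0 < d) (hN : 0 < N)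
    (hf : IsRegularObjective f L₀ L₁ L₂) (hL₀ : 0 < L₀)
    (hx : Measurable[𝒢] x) (hx' : ∀ ω, x' ω = x ω + s ω)
    (hξ : IsSampledWithoutReplacement μ 𝒢 ξ) {C ζ : ℝ} (hC : 0 ≤ C) (hζ₀ : 0 < ζ) (hζ₁ : ζ < 1) :
    1 - ζ ≤ μ.real {ω | GradientSampleSize L₀ C ζ (ξ ω) (x ω) (x' ω) →
      GradientInexact f C (ξ ω) (x ω) (s ω)} := by
  have hd1 : (1 : ℝ) ≤ d := by exact_mod_cast hd
  set r := Real.log (2 * ((d : ℝ) + 1) / ζ) with hr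
  have harg : 1 < 2 * ((d : ℝ) + 1) / ζ := by rw [lt_div_iff₀ hζ₀]; linarith
  have hr0 : 0 < r := Real.log_pos harg
  -- The left side is `e ζ / (2 (d + 1))`, and `e < 3 < 4 ≤ 2 (d + 1)`.
  have hexp : Real.exp √(1 + ‖(0 : EuclideanSpace ℝ (Fin d))‖ ^ 2) * Real.exp (-r) ≤ ζ := by
    rw [Real.exp_neg, hr, Real.exp_log (by linarith), inv_div, mul_div_assoc',
      div_le_iff₀ (by positivity), norm_zero, zero_pow two_ne_zero, add_zero, Real.sqrt_one]
    nlinarith [Real.exp_one_lt_three]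
  have key := hξ.measureReal_norm_batchMean_sub_le
    (isExpPotential_exp_sqrt (V := EuclideanSpace ℝ (Fin d))) h𝒢 hx
    (v := fun i => gradient (f i)) (fun i => (hf.lipschitz_gradient i).continuous)
    (L := (L₀ : ℝ)) (by exact_mod_cast hL₀)
    (fun i y => norm_gradient_le_of_lipschitzWith (hf.lipschitz i) y) hr0
  -- From here the argument is pointwise in `ω`; monotonicity needs no measurability of `s`.
  refine le_trans (by linarith) (key.trans (measureReal_mono ?_))
  intro ω hω hsize
  have hs : ‖x' ω - x ω‖ = ‖s ω‖ := by rw [hx' ω, add_sub_cancel_left]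
  unfold GradientSampleSize at hsize
  rw [hs, show C ^ 2 * ‖s ω‖ ^ 4 = (C * ‖s ω‖ ^ 2) ^ 2 by ring] at hsize
  obtain ⟨hpos, hle⟩ := pos_and_le_of_inv_le hN (by exact_mod_cast hL₀) hr0 (by positivity) hsize
  unfold GradientInexact
  rw [gradient_objective hf.differentiable]
  exact (hω hpos).trans hle

theorem measureReal_hessianInexact_ge (h𝒢 : 𝒢 ≤ mΩ) (hd : 0 < d) (hN : 0 < N)
    (hf : IsRegularObjective f L₀ L₁ L₂) (hL₁ : 0 < L₁)
    (hx : Measurable[𝒢] x) (hx' : ∀ ω, x' ω = x ω + s ω)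
    (hξ : IsSampledWithoutReplacement μ 𝒢 ξ) {C ζ : ℝ} (hC : 0 ≤ C) (hζ₀ : 0 < ζ) (hζ₁ : ζ < 1) :
    1 - ζ ≤ μ.real {ω | HessianSampleSize L₁ C ζ (ξ ω) (x ω) (x' ω) →
      HessianInexact f C (ξ ω) (x ω) (s ω)} := by
  have hd1 : (1 : ℝ) ≤ d := by exact_mod_cast hd
  have : Nonempty (Fin d) := ⟨⟨0, hd⟩⟩
  set r := Real.log (4 * (d : ℝ) / ζ) with hr
  have harg : 1 < 4 * (d : ℝ) / ζ := by rw [lt_div_iff₀ hζ₀]; linarith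
  have hr0 : 0 < r := Real.log_pos harg
  -- The left side is `2 d * ζ / (4 d) = ζ / 2`.
  have hexp : traceCosh (0 : selfAdjoint.submodule ℝ
      (EuclideanSpace ℝ (Fin d) →L[ℝ] EuclideanSpace ℝ (Fin d))) * Real.exp (-r) ≤ ζ := by
    rw [Real.exp_neg, hr, Real.exp_log (by linarith), inv_div, mul_div_assoc',
      div_le_iff₀ (by positivity), traceCosh_zero, finrank_euclideanSpace_fin]
    nlinarith
  set h : Fin N → EuclideanSpace ℝ (Fin d) → selfAdjoint.submodule ℝ
      (EuclideanSpace ℝ (Fin d) →L[ℝ] EuclideanSpace ℝ (Fin d)) := fun i y =>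
    ⟨hessian (f i) y, isSelfAdjoint_hessian (hf.differentiable i) (hf.differentiable_gradient i y)⟩
    with hh
  have hcoe : ∀ S y, ((batchMean (fun i => h i y) S : selfAdjoint.submodule ℝ
      (EuclideanSpace ℝ (Fin d) →L[ℝ] EuclideanSpace ℝ (Fin d))) :
      EuclideanSpace ℝ (Fin d) →L[ℝ] EuclideanSpace ℝ (Fin d)) = batchHessian f S y := by
    intro S y
    simp [batchMean, batchHessian, hh]
  have key := hξ.measureReal_norm_batchMean_sub_le
    (isExpPotential_traceCosh (V := EuclideanSpace ℝ (Fin d))) h𝒢 hx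
    (v := h) (fun i => (hf.lipschitz_hessian i).continuous.subtype_mk _)
    (L := (L₁ : ℝ)) (by exact_mod_cast hL₁)
    (fun i y => norm_fderiv_le_of_lipschitz ℝ (hf.lipschitz_gradient i)) hr0
  refine le_trans (by linarith) (key.trans (measureReal_mono ?_))
  intro ω hω hsize
  have hs : ‖x' ω - x ω‖ = ‖s ω‖ := by rw [hx' ω, add_sub_cancel_left]
  unfold HessianSampleSize at hsize
  rw [hs, ← mul_pow] at hsize
  obtain ⟨hpos, hle⟩ := pos_and_le_of_inv_le hN (by exact_mod_cast hL₁) hr0 (by positivity) hsize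
  -- A bound in operator norm is uniform over directions, so it may be applied to the
  -- batch-dependent `s ω`.
  have hop : ‖batchHessian f (ξ ω) (x ω) - batchHessian f Finset.univ (x ω)‖ ≤ C * ‖s ω‖ := by
    have := (hω hpos).trans hle
    rwa [← Submodule.norm_coe, Submodule.coe_sub, hcoe, hcoe] at this
  unfold HessianInexact
  rw [hessian_objective hf.differentiable hf.differentiable_gradient]
  refine (ContinuousLinearMap.le_of_opNorm_le _ hop _).trans (le_of_eq ?_)
  ring

end Inexactness

end SubsampledCubic

theorem mainTheorem7 {Ω : Type*} {mΩ : MeasurableSpace Ω} (μ : Measure Ω) [IsProbabilityMeasure μ]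
    (ℱ : Filtration ℕ mΩ) {d N : ℕ} (hd : 0 < d) (hN : 0 < N)
    (f : Fin N → EuclideanSpace ℝ (Fin d) → ℝ) (L₀ L₁ L₂ : ℝ≥0) (hL₀ : 0 < L₀) (hL₁ : 0 < L₁)
    (hf : SubsampledCubic.IsRegularObjective f L₀ L₁ L₂)
    (M : ℝ) (hM : 0 < M) (x₀ : EuclideanSpace ℝ (Fin d))
    (x s : ℕ → Ω → EuclideanSpace ℝ (Fin d)) (ξg ξH : ℕ → Ω → Finset (Fin N))
    (hscr : SubsampledCubic.IsSCR μ ℱ f M x₀ x s ξg ξH)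
    (C₁ C₂ : ℝ) (hC₁ : 0 ≤ C₁) (hC₂ : 0 ≤ C₂) (ζ : ℝ) (hζ₀ : 0 < ζ) (hζ₁ : ζ < 1) :
    (∀ k,
      μ.real {ω | SubsampledCubic.GradientSampleSize L₀ C₁ ζ (ξg k ω) (x k ω) (x (k + 1) ω) →
        SubsampledCubic.GradientInexact f C₁ (ξg k ω) (x k ω) (s (k + 1) ω)} ≥ 1 - ζ ∧
      ((∀ᵐ ω ∂μ, SubsampledCubic.GradientSampleSize L₀ C₁ ζ (ξg k ω) (x k ω) (x (k + 1) ω)) →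
        μ.real {ω | SubsampledCubic.GradientInexact f C₁ (ξg k ω) (x k ω) (s (k + 1) ω)}
          ≥ 1 - ζ)) ∧
    (∀ k,
      μ.real {ω | SubsampledCubic.HessianSampleSize L₁ C₂ ζ (ξH k ω) (x k ω) (x (k + 1) ω) →
        SubsampledCubic.HessianInexact f C₂ (ξH k ω) (x k ω) (s (k + 1) ω)} ≥ 1 - ζ ∧
      ((∀ᵐ ω ∂μ, SubsampledCubic.HessianSampleSize L₁ C₂ ζ (ξH k ω) (x k ω) (x (k + 1) ω)) →
        μ.real {ω | SubsampledCubic.HessianInexact f C₂ (ξH k ω) (x k ω) (s (k + 1) ω)}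
          ≥ 1 - ζ)) := by
  have hG := fun k => SubsampledCubic.measureReal_gradientInexact_ge (ℱ.le k) hd hN hf hL₀
    (hscr.measurable_iterate k) (hscr.update k) (hscr.sampling_gradient k) hC₁ hζ₀ hζ₁
  have hH := fun k => SubsampledCubic.measureReal_hessianInexact_ge (ℱ.le k) hd hN hf hL₁
    (hscr.measurable_iterate k) (hscr.update k) (hscr.sampling_hessian k) hC₂ hζ₀ hζ₁
  exact ⟨fun k => ⟨hG k, SubsampledCubic.le_measureReal_of_ae_of_imp (hG k)⟩,
    fun k => ⟨hH k, SubsampledCubic.le_measureReal_of_ae_of_imp (hH k)⟩⟩
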